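/- All topological spaces are assumed to be regular $T_1$-spaces, and $C_k(X,Y)$ denotes the space of all continuous functions $X\to Y$ with the compact-open topology; $C_k(X)=C_k(X,\mathbb R)$. A class $\mathcal X$ of topological spaces is called $C_k$-stable if it is closed under taking subspaces, homeomorphic images, countable topological sums and countable Tychonoff products, and if $C_k(X,Y)\in\mathcal X$ for every Lindelöf space $X\in\mathcal X$ and every space $Y\in\mathcal X$. For a class $\mathcal X$, let $C_k[\mathcal X]$ denote the smallest $C_k$-stable class containing $\mathcal X$. Let $\mathcal M$ be the class of all metrizable spaces and $\mathcal M_0$ the class of all separable metrizable spaces. Theorem. For a topological space $X$ the following conditions are equivalent: (1) $X$ belongs to $C_k[\mathcal M_0]$; (2) $X$ is Lindelöf and belongs to $C_k[\mathcal M]$; (3) there are separable metrizable spaces $Z$ and $Y$ such that $X$ is homeomorphic to a subspace of $C_k(Z,Y)$; (4) there is a zero-dimensional separable metrizable space $Z$ (i.e. one whose clopen sets form a base of its topology) such that $X$ is homeomorphic to a subspace of $C_k(Z)$. -/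

import Mathlib

open Topology TopologicalSpace

universe u

namespace CkStable

/-- A class (property) of topological spaces living in the universe `u`. -/
abbrev SpaceClass : Type (u + 1) := ∀ (X : Type u) [TopologicalSpace X], Prop

/-- A class of regular `T₁` spaces is stable if it is closed under taking subspaces, homeomorphic
images, countable topological sums and countable Tychonoff products. "Countable" includes finite
and empty index sets. -/
structure IsStable (P : SpaceClass.{u}) : Prop where
  /-- all spaces under consideration are regular `T₁` spaces -/
  t3 : ∀ (X : Type u) [TopologicalSpace X], P X → T3Space X
  subspace : ∀ (X : Type u) [TopologicalSpace X] (S : Set X), P X → P S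
  homeo : ∀ (X Y : Type u) [TopologicalSpace X] [TopologicalSpace Y], X ≃ₜ Y → P X → P Y
  sum : ∀ (ι : Type) [Countable ι] (X : ι → Type u) [∀ i, TopologicalSpace (X i)],
    (∀ i, P (X i)) → P (Σ i, X i)
  prod : ∀ (ι : Type) [Countable ι] (X : ι → Type u) [∀ i, TopologicalSpace (X i)],
    (∀ i, P (X i)) → P (∀ i, X i)

/-- A stable class is `C_k`-stable if it contains the space `C(X, Y)` with the compact-open topology
for every Lindelöf space `X` and every space `Y` of the class. -/
structure IsCkStable (P : SpaceClass.{u}) : Prop extends IsStable P where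
  functionSpace : ∀ (X Y : Type u) [TopologicalSpace X] [TopologicalSpace Y],
    LindelofSpace X → P X → P Y → P C(X, Y)

/-- The `C_k`-stable closure of a class `K`: the smallest `C_k`-stable class containing `K`,
i.e. the intersection of all `C_k`-stable classes that contain `K`. -/
def CkClosure (K : SpaceClass.{u}) : SpaceClass.{u} := fun X _ =>
  ∀ P : SpaceClass.{u}, IsCkStable P → (∀ (Y : Type u) [TopologicalSpace Y], K Y → P Y) → P X

/-- The class of all metrizable spaces. -/
def Metrizable : SpaceClass.{u} := fun X _ => MetrizableSpace X

/-- The class of all separable metrizable spaces. -/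
def SepMetrizable : SpaceClass.{u} := fun X _ => SeparableSpace X ∧ MetrizableSpace X

/-- A space is zero-dimensional if its clopen subsets form a base of the topology. -/
def ZeroDimensional (X : Type u) [TopologicalSpace X] : Prop :=
  IsTopologicalBasis {s : Set X | IsClopen s}

/-- `X` embeds into `Y` if there is a topological embedding of `X` into `Y`. -/
def EmbedsIn (X Y : Type u) [TopologicalSpace X] [TopologicalSpace Y] : Prop :=
  ∃ e : X → Y, IsEmbedding e

end CkStable

/-! Let `K` be the metrizable or the separable metrizable spaces. The spaces embedding into some
`C(Z, Y)`, with `Z` separable metrizable and `Y` in `K`, form a `C_k`-stable class containing `K`,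
hence containing `CkClosure K`.

The hard closure property is the one for `C(X, Y)` with `X` Lindelöf. Being Lindelöf, `X` embeds
into a function space with separable target. It therefore has a countable closed `k`-network
(`hasCountableClosedKNetwork_continuousMap`) and, following Michael, is a compact-covering image of
a zero-dimensional separable metrizable `A`. If `Y` embeds into `C(Z, M)`, then `C(X, Y)` embeds
into `C(A, C(Z, M))` by precomposition, and the latter into `C(A × Z, M)` by the exponential law for
first countable factors (`isEmbedding_uncurryMap`).

The same device makes the domain zero-dimensional in (4), where the target embeds into `C(ℕ, ℝ)`. -/

namespace CkStable

open Set Filter Function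

/-! ### Exponential law and compact-covering maps. -/

section FunctionSpaces

variable {X Y Z A M : Type*} [TopologicalSpace X] [TopologicalSpace Y] [TopologicalSpace Z]
  [TopologicalSpace A] [TopologicalSpace M]

/-- Evaluation is jointly continuous along convergent sequences of arguments. -/
lemma tendsto_eval_of_le_atTop {l : Filter ℕ} (hl : l ≤ atTop) {f : ℕ → C(Z, Y)} {f₀ : C(Z, Y)}
    (hf : Tendsto f l (𝓝 f₀)) {z : ℕ → Z} {z₀ : Z} (hz : Tendsto z atTop (𝓝 z₀)) :
    Tendsto (fun n => f n (z n)) l (𝓝 (f₀ z₀)) := by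
  refine tendsto_nhds.2 fun U hU hzU => ?_
  have hev : ∀ᶠ n in atTop, f₀ (z n) ∈ U :=
    (f₀.continuous.tendsto z₀).comp hz (hU.mem_nhds hzU)
  obtain ⟨N, hN⟩ := eventually_atTop.1 hev
  have hK : IsCompact (insert z₀ (range fun n => z (n + N))) :=
    (hz.comp (tendsto_add_atTop_nat N)).isCompact_insert_range
  have hmaps : MapsTo f₀ (insert z₀ (range fun n => z (n + N))) U := by
    rintro _ (rfl | ⟨n, rfl⟩)
    exacts [hzU, hN _ (Nat.le_add_left N n)]
  filter_upwards [ContinuousMap.tendsto_nhds_compactOpen.1 hf _ hK U hU hmaps,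
    hl (eventually_ge_atTop N)] with n hn hnN
  exact hn (Or.inr ⟨n - N, by simp [Nat.sub_add_cancel hnN]⟩)

lemma continuous_uncurry_of_firstCountable [FirstCountableTopology A] [FirstCountableTopology Z]
    (f : C(A, C(Z, M))) : Continuous fun p : A × Z => f p.1 p.2 := by
  refine continuous_iff_seqContinuous.2 fun p p₀ hp => ?_
  exact tendsto_eval_of_le_atTop le_rfl
    (((f.continuous.tendsto p₀.1).comp (continuous_fst.tendsto p₀)).comp hp)
    ((continuous_snd.tendsto p₀).comp hp)

/-- Uncurrying of continuous maps for first countable domains. -/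
def uncurryMap [FirstCountableTopology A] [FirstCountableTopology Z]
    (f : C(A, C(Z, M))) : C(A × Z, M) :=
  ⟨fun p => f p.1 p.2, continuous_uncurry_of_firstCountable f⟩

/-- Convergence is tested on compact sets `K`, and `K` lies in the product of its projections. These
are compact Hausdorff, hence locally compact, so the classical exponential law applies to them. -/
lemma continuous_uncurryMap [FirstCountableTopology A] [FirstCountableTopology Z]
    [T2Space A] [T2Space Z] :
    Continuous (uncurryMap : C(A, C(Z, M)) → C(A × Z, M)) := by
  refine continuous_iff_continuousAt.2 fun f₀ =>
    (ContinuousMap.tendsto_compactOpen_iff_forall _ _).2 fun K hK => ?_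
  let K₁ : Set A := Prod.fst '' K
  let K₂ : Set Z := Prod.snd '' K
  have : CompactSpace K₁ := isCompact_iff_compactSpace.1 (hK.image continuous_fst)
  have : CompactSpace K₂ := isCompact_iff_compactSpace.1 (hK.image continuous_snd)
  let r : C(C(Z, M), C(K₂, M)) := ⟨_, ContinuousMap.continuous_restrict K₂⟩
  let φ : C(K, K₁ × K₂) :=
    ⟨fun p => (⟨p.1.1, mem_image_of_mem _ p.2⟩, ⟨p.1.2, mem_image_of_mem _ p.2⟩), by fun_prop⟩
  have hc : Continuous fun f : C(A, C(Z, M)) =>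
      (ContinuousMap.uncurry (r.comp (f.restrict K₁))).comp φ :=
    (ContinuousMap.continuous_precomp φ).comp
      (ContinuousMap.continuous_uncurry.comp
        ((ContinuousMap.continuous_postcomp r).comp (ContinuousMap.continuous_restrict K₁)))
  exact hc.tendsto f₀

/-- A tube around `{a} × L` can be shrunk to `N × L` with `N` a compact neighbourhood of `a`.
Mapping `N × L` into `U` is then an open condition on the function. -/
lemma continuous_curry_of_locallyCompact [LocallyCompactSpace A] :
    Continuous (ContinuousMap.curry : C(A × Z, M) → C(A, C(Z, M))) := by
  refine ContinuousMap.continuous_of_continuous_uncurry _ (continuous_iff_continuousAt.2 ?_)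
  rintro ⟨f, a⟩
  refine ContinuousMap.tendsto_nhds_compactOpen.2 fun L hL U hU hmaps => ?_
  have hsub : ({a} : Set A) ×ˢ L ⊆ f ⁻¹' U := by
    rintro ⟨b, z⟩ ⟨rfl, hz⟩
    exact hmaps hz
  obtain ⟨V, W, hV, -, haV, hLW, hVW⟩ :=
    generalized_tube_lemma isCompact_singleton hL (hU.preimage f.continuous) hsub
  obtain ⟨N, hN, hNV, hNc⟩ := local_compact_nhds (hV.mem_nhds (haV rfl))
  have hf : MapsTo f (N ×ˢ L) U := fun p hp => hVW ⟨hNV hp.1, hLW hp.2⟩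
  filter_upwards [prod_mem_nhds (ContinuousMap.eventually_mapsTo (hNc.prod hL) hU hf) hN]
    with p hp z hz
  exact hp.1 ⟨hp.2, hz⟩

lemma continuous_curry_of_t2 [T2Space A] :
    Continuous (ContinuousMap.curry : C(A × Z, M) → C(A, C(Z, M))) := by
  refine continuous_iff_continuousAt.2 fun f₀ =>
    (ContinuousMap.tendsto_compactOpen_iff_forall _ _).2 fun K hK => ?_
  have : CompactSpace K := isCompact_iff_compactSpace.1 hK
  let φ : C(K × Z, A × Z) := ⟨fun p => (p.1, p.2), by fun_prop⟩
  exact (continuous_curry_of_locallyCompact.comp (ContinuousMap.continuous_precomp φ)).tendsto f₀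

lemma isEmbedding_uncurryMap [FirstCountableTopology A] [FirstCountableTopology Z]
    [T2Space A] [T2Space Z] :
    IsEmbedding (uncurryMap : C(A, C(Z, M)) → C(A × Z, M)) :=
  IsEmbedding.of_leftInverse (f := ContinuousMap.curry) (fun _ => rfl)
    continuous_curry_of_t2 continuous_uncurryMap

/-- A continuous map is compact-covering if every compact subset of the codomain is the image of a
compact subset of the domain. -/
def IsCompactCovering (p : A → X) : Prop :=
  ∀ K : Set X, IsCompact K → ∃ L : Set A, IsCompact L ∧ p '' L = K

lemma IsCompactCovering.surjective {p : A → X} (hp : IsCompactCovering p) : Surjective p := by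
  intro x
  obtain ⟨L, -, hL⟩ := hp {x} isCompact_singleton
  obtain ⟨a, -, ha⟩ := hL.symm.subset (mem_singleton x)
  exact ⟨a, ha⟩

/-- If `K = p '' L`, then `f` maps `K` into `U` exactly when `f ∘ p` maps `L` into `U`, so subbasic
open sets are pulled back from subbasic ones. -/
lemma IsCompactCovering.isEmbedding_precomp {p : C(A, X)} (hp : IsCompactCovering p) :
    IsEmbedding fun f : C(X, Y) => f.comp p where
  injective f g h := by
    ext x
    obtain ⟨a, rfl⟩ := hp.surjective x
    exact congr($h a)
  eq_induced := by
    refine le_antisymm (ContinuousMap.continuous_precomp p).le_induced ?_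
    refine le_generateFrom <| forall_mem_image2.2 fun K hK U hU => ?_
    obtain ⟨L, hL, rfl⟩ := hp K hK
    refine ⟨_, ContinuousMap.isOpen_setOfPred_mapsTo hL hU, ?_⟩
    ext f
    simp [MapsTo]

end FunctionSpaces

/-! ### Countable closed `k`-networks of function spaces. -/

/-- The space `X` has a countable `k`-network consisting of closed sets. -/
def HasCountableClosedKNetwork (X : Type*) [TopologicalSpace X] : Prop :=
  ∃ (ι : Type) (_ : Countable ι) (N : ι → Set X), (∀ i, IsClosed (N i)) ∧
    ∀ K U : Set X, IsCompact K → IsOpen U → K ⊆ U →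
      ∃ s : Finset ι, K ⊆ ⋃ i ∈ s, N i ∧ ⋃ i ∈ s, N i ⊆ U

section KNetwork

variable {X Y Z : Type*} [TopologicalSpace X] [TopologicalSpace Y] [TopologicalSpace Z]

lemma HasCountableClosedKNetwork.of_isEmbedding {e : X → Y} (he : IsEmbedding e)
    (h : HasCountableClosedKNetwork Y) : HasCountableClosedKNetwork X := by
  obtain ⟨ι, hι, N, hN, hnet⟩ := h
  refine ⟨ι, hι, fun i => e ⁻¹' N i, fun i => (hN i).preimage he.continuous,
    fun K U hK hU hKU => ?_⟩
  obtain ⟨V, hV, rfl⟩ := he.isOpen_iff.1 hU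
  obtain ⟨s, hs, hsV⟩ := hnet (e '' K) V (hK.image he.continuous) hV (image_subset_iff.2 hKU)
  refine ⟨s, ?_, ?_⟩ <;> rw [← preimage_iUnion₂]
  exacts [image_subset_iff.1 hs, preimage_mono hsV]

/-- A second countable regular space has a sequence of open sets finite unions of which separate
compact sets from disjoint closed sets. -/
lemma exists_seq_isOpen_forall_isCompact (Y : Type*) [TopologicalSpace Y]
    [SecondCountableTopology Y] [RegularSpace Y] :
    ∃ B : ℕ → Set Y, (∀ n, IsOpen (B n)) ∧ ∀ K U : Set Y, IsCompact K → IsOpen U → K ⊆ U →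
      ∃ s : Finset ℕ, K ⊆ ⋃ n ∈ s, B n ∧ closure (⋃ n ∈ s, B n) ⊆ U := by
  obtain ⟨b, hbc, -, hb⟩ := exists_countable_basis Y
  -- Adding `∅` makes the family nonempty, so that it can be enumerated by `ℕ`.
  obtain ⟨B, hB⟩ := (hbc.insert ∅).exists_eq_range (insert_nonempty _ _)
  have hBo : ∀ n, IsOpen (B n) := fun n => by
    rcases hB.symm.subset (mem_range_self n) with h | h
    exacts [h ▸ isOpen_empty, hb.isOpen h]
  refine ⟨B, hBo, fun K U hK hU hKU => ?_⟩
  refine hK.induction_on (p := fun K => ∃ s : Finset ℕ, K ⊆ ⋃ n ∈ s, B n ∧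
    closure (⋃ n ∈ s, B n) ⊆ U) ⟨∅, by simp⟩ ?_ ?_ ?_
  · rintro S T hST ⟨s, hs, hs'⟩
    exact ⟨s, hST.trans hs, hs'⟩
  · classical
    rintro S T ⟨s, hs, hs'⟩ ⟨t, ht, ht'⟩
    refine ⟨s ∪ t, ?_, ?_⟩
    · rw [Finset.set_biUnion_union]
      exact union_subset_union hs ht
    · rw [Finset.set_biUnion_union, closure_union]
      exact union_subset hs' ht'
  · intro x hx
    obtain ⟨F, hF, hFc, hFU⟩ := exists_mem_nhds_isClosed_subset (hU.mem_nhds (hKU hx))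
    obtain ⟨v, hv, hxv, hvF⟩ := hb.mem_nhds_iff.1 hF
    obtain ⟨n, rfl⟩ := hB.subset (mem_insert_of_mem ∅ hv)
    exact ⟨B n, mem_nhdsWithin_of_mem_nhds ((hBo n).mem_nhds hxv), {n}, by simp,
      by simpa using (closure_minimal hvF hFc).trans hFU⟩

/-- A compact set of continuous maps on a first countable space is evenly continuous. -/
lemma isOpen_forall_mem_of_isCompact [FirstCountableTopology Z] {K : Set C(Z, Y)}
    (hK : IsCompact K) {V : Set Y} (hV : IsOpen V) : IsOpen {z | ∀ f ∈ K, f z ∈ V} := by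
  refine isOpen_iff_mem_nhds.2 fun z hz => ?_
  by_contra hmem
  obtain ⟨x, hx, hxn⟩ := exists_seq_forall_of_frequently (l := 𝓝 z)
    (p := fun y => ¬ ∀ f ∈ K, f y ∈ V)
    (fun h => hmem (h.mono fun _ => not_not.1))
  push Not at hxn
  choose f hfK hfV using hxn
  -- Compactness of `K` need not provide convergent subsequences, so a limit is taken along a free
  -- ultrafilter.
  have hle : (hyperfilter ℕ : Filter ℕ) ≤ atTop := Nat.hyperfilter_le_atTop
  obtain ⟨f₀, hf₀, hlim⟩ := hK.ultrafilter_le_nhds' ((hyperfilter ℕ).map f)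
    (Filter.mem_map.2 (univ_mem' hfK))
  have ht := tendsto_eval_of_le_atTop hle hlim hx
  obtain ⟨n, hn⟩ := (ht.eventually (hV.mem_nhds (hz f₀ hf₀))).exists
  exact hfV n hn

/-- The image of `K × C` under evaluation is compact, so finitely many `B' n` cover it with closure
inside `U`. By even continuity the points sent into this union by all of `K` form an open set; it
contains `C`, so finitely many `B n` fit in between. -/
lemma exists_mapsTo_of_isCompact {B : ℕ → Set Z} {B' : ℕ → Set Y}
    [FirstCountableTopology Z]
    (hB : ∀ K U : Set Z, IsCompact K → IsOpen U → K ⊆ U →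
      ∃ s : Finset ℕ, K ⊆ ⋃ n ∈ s, B n ∧ closure (⋃ n ∈ s, B n) ⊆ U)
    (hBo' : ∀ n, IsOpen (B' n))
    (hB' : ∀ K U : Set Y, IsCompact K → IsOpen U → K ⊆ U →
      ∃ s : Finset ℕ, K ⊆ ⋃ n ∈ s, B' n ∧ closure (⋃ n ∈ s, B' n) ⊆ U)
    {K : Set C(Z, Y)} (hK : IsCompact K) {C : Set Z} (hC : IsCompact C) [T2Space Z]
    {U : Set Y} (hU : IsOpen U) (hKC : ∀ f ∈ K, MapsTo f C U) :
    ∃ s t : Finset ℕ, C ⊆ ⋃ n ∈ s, B n ∧ closure (⋃ n ∈ t, B' n) ⊆ U ∧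
      ∀ f ∈ K, MapsTo f (⋃ n ∈ s, B n) (closure (⋃ n ∈ t, B' n)) := by
  have : CompactSpace C := isCompact_iff_compactSpace.1 hC
  have hc : Continuous fun p : C(Z, Y) × C => (p.1.restrict C) p.2 :=
    ContinuousEval.continuous_eval.comp
      (((ContinuousMap.continuous_restrict C).comp continuous_fst).prodMk continuous_snd)
  have himg := (hK.prod (isCompact_univ (X := C))).image hc
  obtain ⟨t, ht, htU⟩ := hB' _ U himg hU (by
    rintro _ ⟨⟨f, z⟩, ⟨hf, -⟩, rfl⟩
    exact hKC f hf z.2)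
  obtain ⟨s, hs, hsO⟩ := hB C _ hC
    (isOpen_forall_mem_of_isCompact hK (isOpen_biUnion fun n (_ : n ∈ t) => hBo' n))
    (fun z hz f hf => ht ⟨(f, ⟨z, hz⟩), ⟨hf, mem_univ _⟩, rfl⟩)
  exact ⟨s, t, hs, htU, fun f hf z hz => subset_closure (hsO (subset_closure hz) f hf)⟩

/-- The network consists of finite intersections of conditions sending a finite union of the `B n`
into the closure of a finite union of the `B' n`. Near each `f ∈ K` a single member suffices, and
compactness of `K` does the rest. -/
theorem hasCountableClosedKNetwork_continuousMap [SecondCountableTopology Z] [T3Space Z]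
    [SecondCountableTopology Y] [T3Space Y] : HasCountableClosedKNetwork C(Z, Y) := by
  obtain ⟨B, -, hB⟩ := exists_seq_isOpen_forall_isCompact Z
  obtain ⟨B', hBo', hB'⟩ := exists_seq_isOpen_forall_isCompact Y
  let N : Finset (Finset ℕ × Finset ℕ) → Set C(Z, Y) := fun T =>
    {f | ∀ p ∈ T, MapsTo f (⋃ n ∈ p.1, B n) (closure (⋃ n ∈ p.2, B' n))}
  refine ⟨Finset (Finset ℕ × Finset ℕ), inferInstance, N, fun T => ?_, fun K W hK hW hKW => ?_⟩
  · simp only [N, ofPred_forall]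
    exact isClosed_biInter fun p _ => ContinuousMap.isClosed_setOfPred_mapsTo isClosed_closure _
  classical
  refine hK.induction_on (p := fun K => ∃ s : Finset (Finset (Finset ℕ × Finset ℕ)),
    K ⊆ ⋃ i ∈ s, N i ∧ ⋃ i ∈ s, N i ⊆ W) ⟨∅, by simp⟩ ?_ ?_ ?_
  · rintro S T hST ⟨s, hs, hs'⟩
    exact ⟨s, hST.trans hs, hs'⟩
  · rintro S T ⟨s, hs, hs'⟩ ⟨t, ht, ht'⟩
    refine ⟨s ∪ t, ?_, ?_⟩
    · rw [Finset.set_biUnion_union]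
      exact union_subset_union hs ht
    · rw [Finset.set_biUnion_union]
      exact union_subset hs' ht'
  · intro f hf
    obtain ⟨S, hSfin, hS, hSW⟩ := ContinuousMap.mem_nhds_iff.1 (hW.mem_nhds (hKW hf))
    have hG : {g : C(Z, Y) | ∀ p ∈ S, MapsTo g p.1 p.2} ∈ 𝓝 f := by
      simp only [ofPred_forall]
      exact (biInter_mem hSfin).2 fun p hp =>
        ContinuousMap.eventually_mapsTo (hS p.1 p.2 hp).1 (hS p.1 p.2 hp).2.1 (hS p.1 p.2 hp).2.2
    -- Cutting `K` by a closed neighbourhood inside the basic one keeps it compact, and all its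
    -- elements satisfy the conditions in `S`.
    obtain ⟨F, hF, hFc, hFG⟩ := exists_mem_nhds_isClosed_subset hG
    have hKF : IsCompact (K ∩ F) := hK.inter_right hFc
    choose! s t hs ht hst using fun (p : Set Z × Set Y) (hp : p ∈ S) =>
      exists_mapsTo_of_isCompact hB hBo' hB' hKF (hS p.1 p.2 hp).1 (hS p.1 p.2 hp).2.1
        (fun g hg => hFG hg.2 p hp)
    refine ⟨K ∩ F, inter_mem self_mem_nhdsWithin (mem_nhdsWithin_of_mem_nhds hF),
      {hSfin.toFinset.image fun p => (s p, t p)}, fun g hg => ?_, fun g hg => hSW ?_⟩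
    · simp only [Finset.mem_singleton, iUnion_iUnion_eq_left, N, mem_ofPred_eq, Finset.mem_image,
        Finite.mem_toFinset, forall_exists_index, and_imp, forall_apply_eq_imp_iff₂]
      exact fun p hp => hst p hp g hg
    · simp only [Finset.mem_singleton, iUnion_iUnion_eq_left, N, mem_ofPred_eq, Finset.mem_image,
        Finite.mem_toFinset, forall_exists_index, and_imp, forall_apply_eq_imp_iff₂] at hg
      intro C U hCU
      exact ((hg (C, U) hCU).mono_left (hs (C, U) hCU)).mono_right (ht (C, U) hCU)

end KNetwork

/-! ### Compact-covering images of zero-dimensional spaces. -/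

section Michael

variable {X : Type*} [TopologicalSpace X]

lemma isTopologicalBasis_isClopen_of_isInducing {A B : Type*} [TopologicalSpace A]
    [TopologicalSpace B] {e : A → B} (he : IsInducing e)
    (hB : IsTopologicalBasis {s : Set B | IsClopen s}) :
    IsTopologicalBasis {s : Set A | IsClopen s} := by
  refine isTopologicalBasis_of_isOpen_of_nhds (fun s hs => hs.isOpen) fun a U ha hU => ?_
  obtain ⟨V, hV, rfl⟩ := he.isOpen_iff.1 hU
  obtain ⟨W, hW, haW, hWV⟩ := hB.exists_subset_of_mem_open ha hV
  exact ⟨e ⁻¹' W, IsClopen.preimage hW he.continuous, haW, preimage_mono hWV⟩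

lemma isTopologicalBasis_isClopen_pi {ι : Type*} {D : ι → Type*} [∀ i, TopologicalSpace (D i)]
    [∀ i, DiscreteTopology (D i)] : IsTopologicalBasis {s : Set (∀ i, D i) | IsClopen s} := by
  refine isTopologicalBasis_of_isOpen_of_nhds (fun s hs => hs.isOpen) fun a U ha hU => ?_
  obtain ⟨I, u, hu, hIU⟩ := isOpen_pi_iff.1 hU a ha
  refine ⟨(I : Set ι).pi fun i => {a i}, ⟨?_, ?_⟩, fun i _ => rfl, fun b hb => hIU fun i hi => ?_⟩
  · exact isClosed_set_pi fun i _ => isClosed_discrete _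
  · exact isOpen_set_pi I.finite_toSet fun i _ => isOpen_discrete _
  · rw [show b i = a i from hb i hi]
    exact (hu i hi).2

lemma isTopologicalBasis_isClopen_prod {A D : Type*} [TopologicalSpace A] [TopologicalSpace D]
    [DiscreteTopology D] (hA : IsTopologicalBasis {s : Set A | IsClopen s}) :
    IsTopologicalBasis {s : Set (A × D) | IsClopen s} := by
  refine isTopologicalBasis_of_isOpen_of_nhds (fun s hs => hs.isOpen) ?_
  rintro ⟨a, d⟩ U ha hU
  obtain ⟨W, hW, haW, hWU⟩ := hA.exists_subset_of_mem_open (u := (fun b => (b, d)) ⁻¹' U) ha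
    (hU.preimage (by fun_prop))
  refine ⟨W ×ˢ {d}, IsClopen.prod hW (isClopen_discrete _), ⟨haW, rfl⟩, ?_⟩
  rintro ⟨b, c⟩ ⟨hb, rfl⟩
  exact hWU hb

/-- A regular space with a countable closed `k`-network is the image of a zero-dimensional
separable metrizable space under a continuous compact-covering map. -/
theorem HasCountableClosedKNetwork.exists_isCompactCovering [T3Space X]
    (h : HasCountableClosedKNetwork X) :
    ∃ (A : Type u) (_ : TopologicalSpace A), SepMetrizable A ∧ ZeroDimensional A ∧
      ∃ p : C(A, X), IsCompactCovering p := by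
  classical
  obtain ⟨ι, hι, N, hN, hnet⟩ := h
  let : TopologicalSpace (Option ι) := ⊥
  have : DiscreteTopology (Option ι) := ⟨rfl⟩
  -- `σ` codes `x`: it selects at most one index per finite set (`none` for no selection), the
  -- selected members contain `x`, and they include arbitrarily small ones.
  let R : (Finset ι → Option ι) → X → Prop := fun σ x => (∀ s, ∀ i ∈ σ s, x ∈ N i) ∧
    ∀ U ∈ 𝓝 x, ∃ s, ∃ i ∈ σ s, N i ⊆ U
  have huniq : ∀ σ x y, R σ x → R σ y → x = y := by
    intro σ x y hx hy
    by_contra hxy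
    obtain ⟨s, i, hi, hiU⟩ := hy.2 _ (isOpen_ne.mem_nhds (Ne.symm hxy))
    exact hiU (hx.1 s i hi) rfl
  let S : Set (Finset ι → Option ι) := {σ | ∃ x, R σ x}
  choose p hp using fun σ : S => σ.2
  have hpc : Continuous p := by
    refine continuous_iff_continuousAt.2 fun σ U hU => ?_
    obtain ⟨s, i, hi, hiU⟩ := (hp σ).2 U hU
    have hop : IsOpen {τ : S | τ.1 s = σ.1 s} :=
      (isOpen_discrete {σ.1 s}).preimage 
        (f := fun τ : S => τ.1 s) ((continuous_apply s).comp continuous_subtype_val)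
    refine Filter.mem_map.2 (mem_of_superset (hop.mem_nhds rfl) fun τ hτ => ?_)
    exact hiU ((hp τ).1 s i ((show τ.1 s = σ.1 s from hτ) ▸ hi))
  have hsep : SecondCountableTopology (ULift.{u} S) :=
    Homeomorph.ulift.isInducing.secondCountableTopology
  have hind : IsInducing (Subtype.val ∘ ULift.down : ULift.{u} S → (Finset ι → Option ι)) :=
    IsInducing.subtypeVal.comp Homeomorph.ulift.isInducing
  refine ⟨ULift.{u} S, inferInstance, ⟨inferInstance, IsEmbedding.uliftDown.metrizableSpace⟩,
    isTopologicalBasis_isClopen_of_isInducing hind isTopologicalBasis_isClopen_pi,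
    ⟨p ∘ ULift.down, hpc.comp continuous_uliftDown⟩, fun K hK => ?_⟩
  -- Codes of points of `K` are sought where a cover `s` of `K` selects one of its own members and a
  -- non-cover selects nothing. Finitely many choices per coordinate make the product compact.
  let F : Finset ι → Set (Option ι) := fun s =>
    if K ⊆ ⋃ i ∈ s, N i then some '' (s : Set ι) else {none}
  have hF : ∀ s, (F s).Finite := fun s => by
    dsimp only [F]
    split_ifs
    exacts [s.finite_toSet.image _, finite_singleton _]
  let T : Set ((Finset ι → Option ι) × X) := {q | ∀ s, ∀ i ∈ q.1 s, q.2 ∈ N i}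
  have hT : IsClosed T := by
    simp only [T, ofPred_forall]
    refine isClosed_iInter fun s => isClosed_iInter fun i => ?_
    have : {q : (Finset ι → Option ι) × X | i ∈ q.1 s → q.2 ∈ N i} =
        ((fun q : (Finset ι → Option ι) × X => q.1 s) ⁻¹' {some i})ᶜ ∪ Prod.snd ⁻¹' N i := by
      ext q
      simp [imp_iff_not_or]
    rw [this]
    exact (((isOpen_discrete _).preimage (by fun_prop)).isClosed_compl).union
      ((hN i).preimage continuous_snd)
  have hL₀ : IsCompact (Prod.fst '' ((univ.pi F ×ˢ K) ∩ T)) :=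
    (((isCompact_univ_pi fun s => (hF s).isCompact).prod hK).inter_right hT).image continuous_fst
  have hR : ∀ σ ∈ univ.pi F, ∀ x ∈ K, (∀ s, ∀ i ∈ σ s, x ∈ N i) → R σ x := by
    refine fun σ hσ x hx hσx => ⟨hσx, fun U hU => ?_⟩
    obtain ⟨V, hVU, hV, hxV⟩ := mem_nhds_iff.1 hU
    obtain ⟨C, hC, hCc, hCV⟩ := exists_mem_nhds_isClosed_subset (hV.mem_nhds hxV)
    obtain ⟨O, hOC, hO, hxO⟩ := mem_nhds_iff.1 hC
    -- `s` covers the part of `K` near `x` inside `V`, while `t` covers the rest and avoids `x`. The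
    -- index selected by the cover `s ∪ t` belongs to a member containing `x`, so it comes from `s`.
    obtain ⟨s, hs, hsV⟩ := hnet (K ∩ C) V (hK.inter_right hCc) hV (inter_subset_right.trans hCV)
    obtain ⟨t, ht, htO⟩ := hnet (K \ O) {x}ᶜ (hK.diff hO) isOpen_compl_singleton
      (fun y hy hyx => hy.2 (mem_singleton_iff.1 hyx ▸ hxO))
    have hcov : K ⊆ ⋃ i ∈ s ∪ t, N i := by
      intro y hy
      rw [Finset.set_biUnion_union]
      by_cases hyO : y ∈ O
      exacts [Or.inl (hs ⟨hy, hOC hyO⟩), Or.inr (ht ⟨hy, hyO⟩)]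
    have hmem := hσ (s ∪ t) (mem_univ _)
    simp only [F, if_pos hcov] at hmem
    obtain ⟨i, hi, his⟩ := hmem
    refine ⟨s ∪ t, i, his.symm, ?_⟩
    rcases Finset.mem_union.1 hi with hi | hi
    · exact ((subset_biUnion_of_mem (u := N) hi).trans hsV).trans hVU
    · exact absurd rfl (htO (mem_biUnion hi (hσx _ i his.symm)))
  have hL : IsCompact (Subtype.val ⁻¹' (Prod.fst '' ((univ.pi F ×ˢ K) ∩ T)) : Set S) := by
    rw [IsInducing.subtypeVal.isCompact_preimage_iff]
    · exact hL₀
    · rintro _ ⟨⟨σ, x⟩, ⟨⟨hσ, hx⟩, hT⟩, rfl⟩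
      exact ⟨⟨σ, x, hR σ hσ x hx hT⟩, rfl⟩
  refine ⟨ULift.down ⁻¹' _, (Homeomorph.ulift.isCompact_preimage).2 hL, ?_⟩
  ext x
  constructor
  · rintro ⟨⟨τ, hτ⟩, ⟨⟨σ, y⟩, ⟨⟨hσ, hy⟩, hT⟩, rfl : σ = τ⟩, rfl⟩
    have : p ⟨σ, hτ⟩ = y := huniq _ _ _ (hp ⟨σ, hτ⟩) (hR σ hσ y hy hT)
    exact mem_of_eq_of_mem this hy
  · intro hx
    have : ∀ s, ∃ o ∈ F s, ∀ i ∈ o, x ∈ N i := fun s => by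
      by_cases hs : K ⊆ ⋃ i ∈ s, N i
      · obtain ⟨i, hi, hxi⟩ := mem_iUnion₂.1 (hs hx)
        exact ⟨some i, by simp only [F, if_pos hs]; exact mem_image_of_mem _ hi, by simpa using hxi⟩
      · exact ⟨none, by simp [F, if_neg hs], by simp⟩
    choose σ hσF hσ using this
    have hRσ := hR σ (fun s _ => hσF s) x hx hσ
    exact ⟨⟨⟨σ, x, hRσ⟩⟩, ⟨(σ, x), ⟨⟨fun s _ => hσF s, hx⟩, hσ⟩, rfl⟩, huniq _ _ _ (hp _) hRσ⟩

end Michael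

/-! ### Separable metrizable spaces. -/

lemma SepMetrizable.secondCountableTopology {Z : Type u} [TopologicalSpace Z]
    (h : SepMetrizable Z) : SecondCountableTopology Z := by
  obtain ⟨_, _⟩ := h
  let := metrizableSpaceMetric Z
  exact UniformSpace.secondCountable_of_separable Z

lemma sepMetrizable_of_secondCountable (Z : Type u) [TopologicalSpace Z] [T3Space Z]
    [SecondCountableTopology Z] : SepMetrizable Z :=
  ⟨inferInstance, inferInstance⟩

/-- A separable metrizable space embeds into the space of real sequences. -/
lemma SepMetrizable.exists_isEmbedding_nat_real {Y : Type u} [TopologicalSpace Y]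
    (h : SepMetrizable Y) : ∃ e : Y → ℕ → ℝ, IsEmbedding e := by
  obtain ⟨_, _⟩ := h
  rcases isEmpty_or_nonempty Y with _ | _
  · exact ⟨isEmptyElim, .of_subsingleton _⟩
  let := metrizableSpaceMetric Y
  let d := denseSeq Y
  have hd : DenseRange d := denseRange_denseSeq Y
  let e : Y → ℕ → ℝ := fun y n => dist y (d n)
  have hec : Continuous e := by fun_prop
  have hind : IsInducing e := by
    refine isInducing_iff_nhds.2 fun y => le_antisymm (hec.tendsto y).le_comap ?_
    refine Metric.nhds_basis_ball.ge_iff.2 fun ε hε => ?_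
    obtain ⟨n, hn⟩ := hd.exists_dist_lt y (half_pos hε)
    have hV : {f : ℕ → ℝ | f n < ε / 2} ∈ 𝓝 (e y) :=
      (isOpen_lt (continuous_apply n) continuous_const).mem_nhds hn
    refine mem_of_superset (preimage_mem_comap hV) fun x hx => ?_
    have hx' : dist x (d n) < ε / 2 := hx
    have := dist_triangle_right x y (d n)
    rw [Metric.mem_ball]
    linarith
  exact ⟨e, hind.isEmbedding⟩

/-! ### Function spaces on topological sums. -/

section Sigma

variable {ι : Type*} {Z : ι → Type*} [∀ i, TopologicalSpace (Z i)] {Y : Type*}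
  [TopologicalSpace Y]

/-- Glueing of continuous maps on the summands of a topological sum. -/
def glueSigma (f : ∀ i, C(Z i, Y)) : C(Σ i, Z i, Y) :=
  ⟨fun p => f p.1 p.2, continuous_sigma fun i => (f i).continuous⟩

/-- The inverse is restriction to the summands. A compact subset of the sum meets only finitely many
of them, so a subbasic condition on the glued map involves finitely many coordinates. -/
lemma isEmbedding_glueSigma : IsEmbedding (glueSigma : (∀ i, C(Z i, Y)) → C(Σ i, Z i, Y)) := by
  refine IsEmbedding.of_leftInverse
    (f := fun g i => g.comp (ContinuousMap.mk (Sigma.mk i) continuous_sigmaMk)) (fun _ => rfl)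
    (continuous_pi fun i => ContinuousMap.continuous_precomp _) ?_
  refine ContinuousMap.continuous_compactOpen.2 fun K hK U hU => ?_
  let t : TopologicalSpace ι := ⊥
  have : DiscreteTopology ι := ⟨rfl⟩
  have hfin : (Sigma.fst '' K).Finite :=
    (hK.image (continuous_sigma fun i => continuous_const)).finite_of_discrete
  have : {f : ∀ i, C(Z i, Y) | MapsTo (glueSigma f) K U} =
      ⋂ i ∈ Sigma.fst '' K, {f | MapsTo (f i) (Sigma.mk i ⁻¹' K) U} := by
    ext f
    simp only [mem_ofPred_eq, mem_iInter]
    exact ⟨fun h i _ z hz => h hz, fun h p hp => h p.1 (mem_image_of_mem _ hp) hp⟩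
  rw [this]
  exact hfin.isOpen_biInter fun i _ =>
    (ContinuousMap.isOpen_setOfPred_mapsTo (IsClosedEmbedding.sigmaMk.isCompact_preimage hK)
      hU).preimage (f := fun f : ∀ i, C(Z i, Y) => f i) (continuous_apply i)

end Sigma

/-! ### The class of subspaces of function spaces and its stability. -/

/-- The class of spaces embedding into `C(Z, Y)` with `Z` separable metrizable and `Y` in `K`. -/
def EmbedsInFunctionSpace (K : SpaceClass.{u}) : SpaceClass.{u} := fun X _ =>
  ∃ (Z Y : Type u) (_ : TopologicalSpace Z) (_ : TopologicalSpace Y),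
    SepMetrizable Z ∧ K Y ∧ EmbedsIn X C(Z, Y)

/-- A class of metrizable spaces containing the one-point space and closed under countable sums. -/
structure IsSumClosed (K : SpaceClass.{u}) : Prop where
  metrizable : ∀ (Y : Type u) [TopologicalSpace Y], K Y → MetrizableSpace Y
  punit : K PUnit
  sum : ∀ (ι : Type) [Countable ι] (Y : ι → Type u) [∀ i, TopologicalSpace (Y i)],
    (∀ i, K (Y i)) → K (Σ i, Y i)

lemma metrizableSpace_sigma {ι : Type*} (Y : ι → Type*) [∀ i, TopologicalSpace (Y i)]
    [∀ i, MetrizableSpace (Y i)] : MetrizableSpace (Σ i, Y i) := by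
  let := fun i => metrizableSpaceMetric (Y i)
  let : MetricSpace (Σ i, Y i) := Metric.Sigma.metricSpace
  infer_instance

lemma isSumClosed_metrizable : IsSumClosed Metrizable.{u} where
  metrizable _ _ h := h
  punit := show MetrizableSpace PUnit from inferInstance
  sum _ _ Y _ h :=
    have : ∀ i, MetrizableSpace (Y i) := h
    metrizableSpace_sigma Y

lemma isSumClosed_sepMetrizable : IsSumClosed SepMetrizable.{u} where
  metrizable _ _ h := h.2
  punit := ⟨inferInstance, inferInstance⟩
  sum _ _ Y _ h := by
    have := fun i => (h i).2
    have := fun i => (h i).secondCountableTopology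
    exact ⟨inferInstance, metrizableSpace_sigma Y⟩

section Reduction

variable {X : Type u} [TopologicalSpace X]

lemma EmbedsInFunctionSpace.t3Space {K : SpaceClass.{u}} (hK : IsSumClosed K)
    (h : EmbedsInFunctionSpace K X) : T3Space X := by
  obtain ⟨Z, Y, _, _, -, hY, e, he⟩ := h
  have := hK.metrizable Y hY
  exact he.t3Space

lemma EmbedsInFunctionSpace.of_mem {K : SpaceClass.{u}} (h : K X) :
    EmbedsInFunctionSpace K X :=
  ⟨PUnit, X, inferInstance, inferInstance, isSumClosed_sepMetrizable.punit, h, _,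
    (Homeomorph.continuousMapOfUnique (X := PUnit) (Y := X)).isEmbedding⟩

/-- A space that embeds into `C(Z, Y)` for separable metrizable `Z` and `Y` is the image of a
zero-dimensional separable metrizable space under a compact-covering map. -/
lemma EmbedsInFunctionSpace.exists_isCompactCovering
    (h : EmbedsInFunctionSpace SepMetrizable.{u} X) :
    ∃ (A : Type u) (_ : TopologicalSpace A), SepMetrizable A ∧ ZeroDimensional A ∧
      ∃ p : C(A, X), IsCompactCovering p := by
  have := h.t3Space isSumClosed_sepMetrizable
  obtain ⟨Z, Y, _, _, hZ, hY, e, he⟩ := h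
  have := hZ.secondCountableTopology
  have := hY.secondCountableTopology
  have := hZ.2
  have := hY.2
  exact (hasCountableClosedKNetwork_continuousMap.of_isEmbedding he).exists_isCompactCovering

lemma EmbedsInFunctionSpace.lindelofSpace (h : EmbedsInFunctionSpace SepMetrizable.{u} X) :
    LindelofSpace X := by
  obtain ⟨A, _, hA, -, p, hp⟩ := h.exists_isCompactCovering
  have := hA.secondCountableTopology
  exact LindelofSpace.of_continuous_surjective p.continuous hp.surjective

/-- If a Lindelöf space embeds into `C(Z, Y)` with `Z` separable and `Y` metrizable, then the
target can be replaced by a separable subspace. -/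
lemma EmbedsInFunctionSpace.sepMetrizable_of_lindelofSpace [LindelofSpace X]
    (h : EmbedsInFunctionSpace Metrizable.{u} X) : EmbedsInFunctionSpace SepMetrizable.{u} X := by
  obtain ⟨Z, Y, _, _, hZ, hY, e, he⟩ := h
  have : MetrizableSpace Y := hY
  have := hZ.1
  obtain ⟨D, hDc, hDd⟩ := exists_countable_dense Z
  have hD := hDc.to_subtype
  -- By density of `D` and continuity all values lie in `S`. Each evaluation has Lindelöf range,
  -- which is separable in a metrizable space.
  let S : Set Y := closure (⋃ z : D, range fun x => e x z)
  have hS : IsSeparable S := by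
    refine (IsSeparable.iUnion fun z : D => ?_).closure
    have hl := isLindelof_range ((continuous_eval_const (F := C(Z, Y)) (z : Z)).comp he.continuous)
    have : LindelofSpace (range fun x => e x z) := isLindelof_iff_lindelofSpace.1 hl
    exact IsSeparable.of_subtype _
  have hmem : ∀ x z, e x z ∈ S := fun x z =>
    (map_mem_closure (e x).continuous (hDd z) fun d hd => mem_iUnion.2 ⟨⟨d, hd⟩, x, rfl⟩)
  let e' : X → C(Z, S) := fun x => ⟨fun z => ⟨e x z, hmem x z⟩, by fun_prop⟩
  let i : C(S, Y) := ⟨Subtype.val, continuous_subtype_val⟩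
  have hi : IsEmbedding (fun f : C(Z, S) => i.comp f) :=
    ContinuousMap.isEmbedding_postcomp i IsEmbedding.subtypeVal
  exact ⟨Z, S, inferInstance, inferInstance, hZ, ⟨hS.separableSpace, inferInstance⟩, e',
    hi.of_comp_iff.1 he⟩

end Reduction

section Stability

variable {K : SpaceClass.{u}}

lemma EmbedsInFunctionSpace.of_isEmbedding {X Y : Type u} [TopologicalSpace X]
    [TopologicalSpace Y] {e : X → Y} (he : IsEmbedding e) (h : EmbedsInFunctionSpace K Y) :
    EmbedsInFunctionSpace K X := by
  obtain ⟨Z, W, _, _, hZ, hW, f, hf⟩ := h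
  exact ⟨Z, W, _, _, hZ, hW, f ∘ e, hf.comp he⟩

lemma EmbedsInFunctionSpace.of_subsingleton (hK : IsSumClosed K) (X : Type u)
    [TopologicalSpace X] [Subsingleton X] : EmbedsInFunctionSpace K X :=
  .of_isEmbedding (e := fun _ => PUnit.unit) (.of_subsingleton _) (.of_mem hK.punit)

/-- The targets are placed in the common space `Σ i, Y i`, after which the factors glue to maps on
`Σ i, Z i`. -/
lemma EmbedsInFunctionSpace.pi (hK : IsSumClosed K) {ι : Type} [Countable ι] (X : ι → Type u)
    [∀ i, TopologicalSpace (X i)] (h : ∀ i, EmbedsInFunctionSpace K (X i)) :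
    EmbedsInFunctionSpace K (∀ i, X i) := by
  choose Z Y tZ tY hZ hY e he using h
  refine ⟨Σ i, Z i, Σ i, Y i, inferInstance, inferInstance, isSumClosed_sepMetrizable.sum ι Z hZ,
    hK.sum ι Y hY, _, isEmbedding_glueSigma.comp (IsEmbedding.piMap fun i =>
      (ContinuousMap.isEmbedding_postcomp ⟨Sigma.mk i, continuous_sigmaMk⟩
        IsEmbedding.sigmaMk).comp (he i))⟩

/-- The domain of the function space may be assumed to be nonempty. -/
lemma EmbedsInFunctionSpace.exists_nonempty (hK : IsSumClosed K) {X : Type u}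
    [TopologicalSpace X] (h : EmbedsInFunctionSpace K X) :
    ∃ (Z Y : Type u) (_ : TopologicalSpace Z) (_ : TopologicalSpace Y),
      SepMetrizable Z ∧ K Y ∧ EmbedsIn X C(Z, Y) ∧ Nonempty Z := by
  obtain ⟨Z, Y, _, _, hZ, hY, e, he⟩ := h
  rcases isEmpty_or_nonempty Z with _ | hne
  · have : Subsingleton C(Z, Y) := ⟨fun f g => ContinuousMap.ext isEmptyElim⟩
    have := he.injective.subsingleton
    exact ⟨PUnit, PUnit, inferInstance, inferInstance, isSumClosed_sepMetrizable.punit, hK.punit,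
      ⟨fun _ => ContinuousMap.const _ PUnit.unit, .of_subsingleton _⟩, inferInstance⟩
  · exact ⟨Z, Y, _, _, hZ, hY, ⟨e, he⟩, hne⟩

lemma EmbedsInFunctionSpace.sigma (hK : IsSumClosed K) {ι : Type} [Countable ι]
    (X : ι → Type u) [∀ i, TopologicalSpace (X i)] (h : ∀ i, EmbedsInFunctionSpace K (X i)) :
    EmbedsInFunctionSpace K (Σ i, X i) := by
  classical
  rcases isEmpty_or_nonempty (Σ i, X i) with _ | ⟨⟨i₀, x₀⟩⟩
  · exact .of_subsingleton hK _
  choose Z Y tZ tY hZ hY hXe hne using fun i => (h i).exists_nonempty hK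
  choose e he using hXe
  have : Nonempty (Σ i, Z i) := ⟨⟨i₀, Classical.choice (hne i₀)⟩⟩
  -- Any point of the common target would do: it is the constant value off the `i`-th summand, which
  -- lets every `X i` embed into the same function space.
  let c : Σ i, Y i := ⟨i₀, e i₀ x₀ (Classical.choice (hne i₀))⟩
  have hemb : ∀ i, IsEmbedding fun x : X i =>
      glueSigma (update (fun j => ContinuousMap.const (Z j) c) i
        ((ContinuousMap.mk (Sigma.mk i) continuous_sigmaMk).comp (e i x))) := by
    intro i
    have hup : IsEmbedding fun f : C(Z i, Σ i, Y i) =>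
        update (fun j => ContinuousMap.const (Z j) c) i f :=
      IsEmbedding.of_leftInverse (f := fun g => g i) (fun f => update_self _ _ _)
        (continuous_apply i) (continuous_const.update i continuous_id)
    exact (isEmbedding_glueSigma.comp hup).comp ((ContinuousMap.isEmbedding_postcomp
      ⟨Sigma.mk i, continuous_sigmaMk⟩ IsEmbedding.sigmaMk).comp (he i))
  -- The extra index in the target records the summand of `Σ i, X i`. It can be read off a function
  -- only when the domain is nonempty.
  refine ⟨Σ i, Z i, Σ _ : ι, Σ i, Y i, inferInstance, inferInstance,
    isSumClosed_sepMetrizable.sum ι Z hZ, hK.sum ι _ fun _ => hK.sum ι Y hY, _,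
    ContinuousMap.isEmbedding_sigmaMk_comp.comp ((isEmbedding_sigmaMap injective_id).2 hemb)⟩

lemma EmbedsInFunctionSpace.continuousMap (hK : IsSumClosed K) {X Y : Type u}
    [TopologicalSpace X] [TopologicalSpace Y] [LindelofSpace X] (hX : EmbedsInFunctionSpace K X)
    (hY : EmbedsInFunctionSpace K Y) : EmbedsInFunctionSpace K C(X, Y) := by
  -- Weakening to a metrizable target makes the Lindelöf reduction available for every `K`.
  have hX' : EmbedsInFunctionSpace Metrizable.{u} X := by
    obtain ⟨Z, W, _, _, hZ, hW, he⟩ := hX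
    exact ⟨Z, W, _, _, hZ, hK.metrizable W hW, he⟩
  obtain ⟨A, _, hA, -, p, hp⟩ := hX'.sepMetrizable_of_lindelofSpace.exists_isCompactCovering
  obtain ⟨Z, M, _, _, hZ, hM, e, he⟩ := hY
  have := hA.2
  have := hZ.2
  have := hA.secondCountableTopology
  have := hZ.secondCountableTopology
  exact ⟨A × Z, M, inferInstance, inferInstance, sepMetrizable_of_secondCountable _, hM, _,
    isEmbedding_uncurryMap.comp ((ContinuousMap.isEmbedding_postcomp ⟨e, he.continuous⟩ he).comp
      hp.isEmbedding_precomp)⟩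

theorem isCkStable_embedsInFunctionSpace (hK : IsSumClosed K) :
    IsCkStable (EmbedsInFunctionSpace K) where
  t3 _ _ h := h.t3Space hK
  subspace _ _ _ h := .of_isEmbedding IsEmbedding.subtypeVal h
  homeo _ _ _ _ φ h := .of_isEmbedding φ.symm.isEmbedding h
  sum _ _ X _ h := .sigma hK X h
  prod _ _ X _ h := .pi hK X h
  functionSpace _ _ _ _ _ hX hY := hX.continuousMap hK hY

lemma CkClosure.embedsInFunctionSpace (hK : IsSumClosed K) {X : Type u} [TopologicalSpace X]
    (h : CkClosure K X) : EmbedsInFunctionSpace K X :=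
  h _ (isCkStable_embedsInFunctionSpace hK) fun _ _ => .of_mem

end Stability

/-! ### Real-valued functions on zero-dimensional spaces, and the equivalence. -/

/-- A space embedding into a function space over separable metrizable spaces embeds into the space
of real-valued functions on a zero-dimensional separable metrizable space. -/
theorem EmbedsInFunctionSpace.exists_zeroDimensional {X : Type u} [TopologicalSpace X]
    (h : EmbedsInFunctionSpace SepMetrizable.{u} X) :
    ∃ (Z : Type u) (_ : TopologicalSpace Z),
      SepMetrizable Z ∧ ZeroDimensional Z ∧ EmbedsIn X C(Z, ℝ) := by
  obtain ⟨Z, Y, _, _, hZ, hY, e, he⟩ := h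
  obtain ⟨A, _, hA, hA₀, p, hp⟩ :=
    (EmbedsInFunctionSpace.of_mem hZ).exists_isCompactCovering
  obtain ⟨f, hf⟩ := hY.exists_isEmbedding_nat_real
  -- Viewing sequences as `C(ℕ, ℝ)` lets uncurrying produce real functions on `A × ℕ`, still
  -- zero-dimensional because `ℕ` is discrete.
  have hf' : IsEmbedding (ContinuousMap.homeoFnOfDiscrete.symm ∘ f : Y → C(ℕ, ℝ)) :=
    ContinuousMap.homeoFnOfDiscrete.symm.isEmbedding.comp hf
  have := hA.2
  have := hA.secondCountableTopology
  exact ⟨A × ℕ, inferInstance, sepMetrizable_of_secondCountable _,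
    isTopologicalBasis_isClopen_prod hA₀, _,
    isEmbedding_uncurryMap.comp ((ContinuousMap.isEmbedding_postcomp ⟨_, hf'.continuous⟩ hf').comp
      (hp.isEmbedding_precomp.comp he))⟩

lemma CkClosure.of_isEmbedding {K : SpaceClass.{u}} {X Y : Type u} [TopologicalSpace X]
    [TopologicalSpace Y] {e : X → Y} (he : IsEmbedding e) (h : CkClosure K Y) : CkClosure K X :=
  fun P hP hKP => hP.homeo _ _ he.toHomeomorph.symm (hP.subspace _ _ (h P hP hKP))

lemma CkClosure.continuousMap_real {Z : Type u} [TopologicalSpace Z] (hZ : SepMetrizable Z) :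
    CkClosure SepMetrizable.{u} C(Z, ℝ) := by
  intro P hP hKP
  have := hZ.secondCountableTopology
  -- `ULift` only moves `ℝ` into the universe of the class.
  exact hP.homeo C(Z, ULift.{u} ℝ) _
    (Homeomorph.arrowCongr (Homeomorph.refl Z) Homeomorph.ulift)
    (hP.functionSpace _ _ inferInstance (hKP Z hZ)
      (hKP _ ⟨inferInstance, IsEmbedding.uliftDown.metrizableSpace⟩))

end CkStable

theorem theoremt (X : Type u) [TopologicalSpace X] [T3Space X] :
    [CkStable.CkClosure CkStable.SepMetrizable.{u} X,
      LindelofSpace X ∧ CkStable.CkClosure CkStable.Metrizable.{u} X,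
      ∃ (Z Y : Type u) (_ : TopologicalSpace Z) (_ : TopologicalSpace Y),
        CkStable.SepMetrizable Z ∧ CkStable.SepMetrizable Y ∧ CkStable.EmbedsIn X C(Z, Y),
      ∃ (Z : Type u) (_ : TopologicalSpace Z),
        CkStable.SepMetrizable Z ∧ CkStable.ZeroDimensional Z ∧
          CkStable.EmbedsIn X C(Z, ℝ)].TFAE := by
  tfae_have 1 → 2 := fun h =>
    ⟨(CkStable.CkClosure.embedsInFunctionSpace CkStable.isSumClosed_sepMetrizable h).lindelofSpace,
      fun P hP hKP => h P hP fun Y _ hY => hKP Y hY.2⟩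
  tfae_have 2 → 3 := fun ⟨_, h⟩ =>
    (CkStable.CkClosure.embedsInFunctionSpace
      CkStable.isSumClosed_metrizable h).sepMetrizable_of_lindelofSpace
  tfae_have 3 → 4 := fun h =>
    CkStable.EmbedsInFunctionSpace.exists_zeroDimensional h
  tfae_have 4 → 1 := by
    rintro ⟨Z, _, hZ, -, e, he⟩
    exact .of_isEmbedding he (.continuousMap_real hZ)
  tfae_finish
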